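/- For an integer $N\ge 0$, real numbers $a,b>0$ and a function $f$ on $[0,1]^N$ put \[ \langle f\rangle_{a,b}=\frac1{N!}\int_{[0,1]^N}f(x_1,\dots,x_N)\prod_{1\le i<j\le N}(x_i-x_j)^2\prod_{i=1}^N x_i^{a-1}(1-x_i)^{b-1}\,dx_1\cdots dx_N . \] Let $\lambda=(\lambda_1\ge\lambda_2\ge\cdots)$ be a partition with $\ell(\lambda)$ nonzero parts and $|\lambda|=\sum_i\lambda_i$, and for $N\ge\ell(\lambda)$ let \[ s_\lambda(x_1,\dots,x_N)=\frac{\det\bigl(x_i^{\lambda_j+N-j}\bigr)_{1\le i,j\le N}}{\prod_{1\le i<j\le N}(x_i-x_j)} \] be the Schur function. (1) For all $N\ge\ell(\lambda)$ and all real $a,b>0$, the integrals $\langle s_\lambda\rangle_{a,b}$ and $\langle 1\rangle_{a,b}$ converge absolutely, $\langle 1\rangle_{a,b}>0$, and \[ \frac{\langle s_\lambda(x_1,\dots,x_N)\rangle_{a,b}}{\langle 1\rangle_{a,b}} =\prod_{i=1}^{\ell(\lambda)}\left[\prod_{j=i+1}^{\ell(\lambda)}\frac{\lambda_i-\lambda_j+j-i}{j-i}\;\prod_{j=0}^{\lambda_i-1}\frac{(j+N-i+1)(a+N-i+j)}{(\ell(\lambda)+j-i+1)(a+b+2N-i+j-1)}\right].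 \] (2) Let $a=a_1N+a_0$ and $b=b_1N+b_0$ with real constants $a_0,a_1,b_0,b_1$ such that $a>0$ and $b>0$ for all sufficiently large $N$. Then \[ \frac{\langle s_\lambda(x_1,\dots,x_N)\rangle_{a,b}}{N^{|\lambda|}\,\langle 1\rangle_{a,b}}\;\xrightarrow[N\to\infty]{}\; \left(\frac{1+a_1}{2+a_1+b_1}\right)^{|\lambda|}\prod_{i=1}^{\ell(\lambda)}\left[\prod_{j=i+1}^{\ell(\lambda)}\frac{\lambda_i-\lambda_j+j-i}{j-i}\;\prod_{j=0}^{\lambda_i-1}\frac1{\ell(\lambda)+j-i+1}\right]. \] -/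

import Mathlib

namespace Selberg

/-- The integrand of `⟨f⟩_{a,b}` in `N` variables, without the factor `1 / N!`:
`f(x) ∏_{i<j} (x_i - x_j)^2 ∏_i x_i^(a-1) (1-x_i)^(b-1)`. -/
noncomputable def integrand (N : ℕ) (a b : ℝ) (f : (Fin N → ℝ) → ℝ) (x : Fin N → ℝ) : ℝ :=
  f x * (∏ i : Fin N, ∏ j ∈ Finset.Ioi i, (x i - x j) ^ 2) *
    ∏ i : Fin N, (x i ^ (a - 1) * (1 - x i) ^ (b - 1))

/-- `⟨f⟩_{a,b} = (1 / N!) ∫_{[0,1]^N} f(x) ∏_{i<j} (x_i - x_j)^2 ∏_i x_i^(a-1) (1-x_i)^(b-1) dx`. -/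
noncomputable def average (N : ℕ) (a b : ℝ) (f : (Fin N → ℝ) → ℝ) : ℝ :=
  1 / (N.factorial : ℝ) * ∫ x in Set.Icc (0 : Fin N → ℝ) 1, integrand N a b f x

/-- A partition `λ` is represented by its Young diagram, the part `λ_{i+1}` being
`lam.rowLen i` (zero past the last row); `length lam` is the number `ℓ(λ)` of nonzero parts. -/
def length (lam : YoungDiagram) : ℕ := lam.colLen 0

/-- `|λ| = ∑_i λ_i`. -/
def size (lam : YoungDiagram) : ℕ := ∑ i ∈ Finset.range (length lam), lam.rowLen i

/-- The Schur function `s_λ(x_1, …, x_N)` for `ℓ(λ) ≤ N`, as the quotient of alternants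
`det (x_i^(λ_j + N - j))_{1 ≤ i, j ≤ N} / ∏_{i<j} (x_i - x_j)`. The indices here start at `0`.
At points with two equal coordinates the quotient is `0` by convention; these points form a null
set, and the squared Vandermonde factor of `integrand` vanishes there. -/
noncomputable def schur (N : ℕ) (lam : YoungDiagram) (x : Fin N → ℝ) : ℝ :=
  (Matrix.of fun i j : Fin N => x i ^ (lam.rowLen j + (N - 1 - (j : ℕ)))).det /
    ∏ i : Fin N, ∏ j ∈ Finset.Ioi i, (x i - x j)

end Selberg

namespace Selberg

/-! The denominator of `s_λ` cancels one of the two Vandermonde factors of the density. With indices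
from 1 and `l_j = λ_j + N - j`, what remains is the integral of the product of the alternants with
exponents `l_j` and `N - k` against a product weight. Andréief's identity (`integral_det_mul_det`)
makes it `N!` times the determinant of the Beta moments `B(a + l_j + N - k, b)`.

Each moment is a factor depending only on `l_j` times a polynomial in `l_j` of degree below `N`
(`moment_eq`). The determinant is therefore the product of the row factors, the Vandermonde of the
`l_j`, and a constant free of `λ` (`det_moment`). That constant need not be evaluated: it is nonzero
because `⟨1⟩ > 0`, and it cancels in the ratio. The interaction of the nonzero rows with the empty
ones telescopes (`prod_Ico_add_div`), leaving a product over rows and boxes of `λ`.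

The number of factors does not depend on `N`, and each box contributes one power of `N`, so the
limit is taken factor by factor. -/

open MeasureTheory Finset

/-! ### Andréief's identity -/

/-- A sum over pairs of permutations of signed products is `n!` times a determinant. -/
theorem sum_perm_sum_perm_sign_mul_prod {n : ℕ} (M : Matrix (Fin n) (Fin n) ℝ) :
    ∑ σ : Equiv.Perm (Fin n), ∑ τ : Equiv.Perm (Fin n),
      ((σ.sign : ℤ) : ℝ) * ((τ.sign : ℤ) : ℝ) * ∏ i, M (σ i) (τ i) = n.factorial * M.det := by
  have h : ∀ σ : Equiv.Perm (Fin n), ∑ τ : Equiv.Perm (Fin n),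
      ((σ.sign : ℤ) : ℝ) * ((τ.sign : ℤ) : ℝ) * ∏ i, M (σ i) (τ i) = M.det := by
    intro σ
    -- Replacing `τ` by `τσ` removes `σ`: its sign then occurs twice, and the product is reindexed
    -- by `σ`.
    rw [← Matrix.det_transpose, Matrix.det_apply', ← Equiv.sum_comp (Equiv.mulRight σ)]
    refine Finset.sum_congr rfl fun τ _ => ?_
    have hs : ((σ.sign : ℤ) : ℝ) * ((σ.sign : ℤ) : ℝ) = 1 := by
      rw [← Int.cast_mul, ← Units.val_mul, Int.units_mul_self]; simp
    have hp : ∏ i, M (σ i) ((τ * σ) i) = ∏ i, M i (τ i) :=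
      Equiv.prod_comp σ fun i => M i (τ i)
    simp only [Equiv.coe_mulRight, hp, Equiv.Perm.sign_mul, Units.val_mul, Int.cast_mul,
      Matrix.transpose_apply]
    linear_combination ((τ.sign : ℤ) : ℝ) * (∏ i, M i (τ i)) * hs
  simp [h, Fintype.card_perm]

theorem det_mul_det_eq_sum {n : ℕ} (f g : Fin n → ℝ → ℝ) (x : Fin n → ℝ) :
    (Matrix.of fun i j => f j (x i)).det * (Matrix.of fun i j => g j (x i)).det =
      ∑ σ : Equiv.Perm (Fin n), ∑ τ : Equiv.Perm (Fin n),
        ((σ.sign : ℤ) : ℝ) * ((τ.sign : ℤ) : ℝ) * ∏ i, (f (σ i) (x i) * g (τ i) (x i)) := by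
  rw [← Matrix.det_transpose, Matrix.det_apply', ← Matrix.det_transpose (Matrix.of _),
    Matrix.det_apply', Finset.sum_mul_sum]
  refine Finset.sum_congr rfl fun σ _ => Finset.sum_congr rfl fun τ _ => ?_
  simp only [Matrix.transpose_apply, Matrix.of_apply, Finset.prod_mul_distrib]
  ring

section Andreief

variable {n : ℕ} {μ : Measure ℝ} [SigmaFinite μ] {f g : Fin n → ℝ → ℝ}

theorem integrable_det_mul_det (h : ∀ j k, Integrable (fun t => f j t * g k t) μ) :
    Integrable (fun x : Fin n → ℝ =>
      (Matrix.of fun i j => f j (x i)).det * (Matrix.of fun i j => g j (x i)).det)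
      (Measure.pi fun _ => μ) := by
  simp_rw [det_mul_det_eq_sum]
  refine integrable_finsetSum _ fun σ _ => integrable_finsetSum _ fun τ _ => ?_
  exact (Integrable.fintype_prod fun i => h (σ i) (τ i)).const_mul _

/-- **Andréief's identity**. -/
theorem integral_det_mul_det (h : ∀ j k, Integrable (fun t => f j t * g k t) μ) :
    ∫ x : Fin n → ℝ,
      (Matrix.of fun i j => f j (x i)).det * (Matrix.of fun i j => g j (x i)).det
      ∂(Measure.pi fun _ => μ) =
    n.factorial * (Matrix.of fun j k => ∫ t, f j t * g k t ∂μ).det := by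
  have hint : ∀ σ τ : Equiv.Perm (Fin n), Integrable (fun x : Fin n → ℝ =>
      ((σ.sign : ℤ) : ℝ) * ((τ.sign : ℤ) : ℝ) * ∏ i, (f (σ i) (x i) * g (τ i) (x i)))
      (Measure.pi fun _ => μ) := fun σ τ =>
    (Integrable.fintype_prod fun i => h (σ i) (τ i)).const_mul _
  simp_rw [det_mul_det_eq_sum]
  rw [integral_finsetSum _ fun σ _ => integrable_finsetSum _ fun τ _ => hint σ τ,
    ← sum_perm_sum_perm_sign_mul_prod]
  refine Finset.sum_congr rfl fun σ _ => ?_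
  rw [integral_finsetSum _ fun τ _ => hint σ τ]
  refine Finset.sum_congr rfl fun τ _ => ?_
  rw [integral_const_mul,
    integral_fintype_prod_eq_prod (fun i t => f (σ i) t * g (τ i) t)]
  rfl

end Andreief

/-! ### Vandermonde determinants -/

theorem prod_sub_eq_det {n : ℕ} (x : Fin n → ℝ) :
    ∏ i : Fin n, ∏ j ∈ Finset.Ioi i, (x i - x j) =
      (Matrix.of fun i j : Fin n => x i ^ (n - 1 - (j : ℕ))).det := by
  have h := Matrix.det_projVandermonde (fun _ : Fin n => (1 : ℝ)) x
  simp only [one_mul] at h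
  rw [← h]
  congr 1
  ext i j
  simp only [Matrix.projVandermonde_apply, Matrix.of_apply, one_pow, one_mul, Fin.val_rev]
  congr 1
  omega

/-- Evaluation is multiplication by the coefficient matrix, so the nodes enter only through their
Vandermonde. -/
theorem det_eval_eq_det_vandermonde_mul {n : ℕ} (v : Fin n → ℝ) (p : Fin n → Polynomial ℝ)
    (hp : ∀ k, (p k).natDegree < n) :
    (Matrix.of fun j k => (p k).eval (v j)).det =
      (Matrix.vandermonde v).det * (Matrix.of fun i k : Fin n => (p k).coeff i).det := by
  rw [← Matrix.det_mul]
  congr 1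
  ext j k
  rw [Matrix.of_apply, Polynomial.eval_eq_sum_range' (hp k), Matrix.mul_apply,
    ← Fin.sum_univ_eq_sum_range (fun i => (p k).coeff i * v j ^ i)]
  exact Finset.sum_congr rfl fun i _ => mul_comm _ _

/-! ### The Beta weight and its moments -/

/-- The weight `x^(a-1) (1-x)^(b-1)`. -/
noncomputable def weight (a b x : ℝ) : ℝ := x ^ (a - 1) * (1 - x) ^ (b - 1)

theorem integrableOn_weight {a b : ℝ} (ha : 0 < a) (hb : 0 < b) :
    IntegrableOn (weight a b) (Set.Icc 0 1) := by
  have h := Complex.betaIntegral_convergent (u := a) (v := b) (by simpa) (by simpa)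
  rw [intervalIntegrable_iff_integrableOn_Ioc_of_le (by simp),
    ← integrableOn_Icc_iff_integrableOn_Ioc] at h
  refine (Integrable.re h).congr (ae_restrict_of_forall_mem measurableSet_Icc fun x hx => ?_)
  simp only [weight]
  norm_cast
  rw [← Complex.ofReal_cpow hx.1, ← Complex.ofReal_cpow (by linarith [hx.2]),
    ← Complex.ofReal_mul]
  exact Complex.ofReal_re _

theorem integral_weight {a b : ℝ} (ha : 0 < a) (hb : 0 < b) :
    ∫ x in Set.Icc (0 : ℝ) 1, weight a b x =
      Real.Gamma a * Real.Gamma b / Real.Gamma (a + b) := by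
  have h := ProbabilityTheory.beta_eq_betaIntegralReal a b ha hb
  rw [ProbabilityTheory.beta] at h
  have hc := Complex.betaIntegral_convergent (u := a) (v := b) (by simpa) (by simpa)
  rw [intervalIntegrable_iff_integrableOn_Ioc_of_le (by simp)] at hc
  rw [h, Complex.betaIntegral, intervalIntegral.integral_of_le (by norm_num),
    integral_Icc_eq_integral_Ioc, ← RCLike.re_to_complex, ← integral_re hc]
  refine setIntegral_congr_fun measurableSet_Ioc fun x hx => ?_
  simp only [weight]
  norm_cast
  rw [← Complex.ofReal_cpow hx.1.le, ← Complex.ofReal_cpow (by linarith [hx.2]),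
    RCLike.re_to_complex, Complex.re_mul_ofReal, Complex.ofReal_re]

/-- The monomial shifts the first parameter of the weight, except at the origin. -/
theorem pow_mul_weight (a b : ℝ) (n : ℕ) :
    (fun x => x ^ n * weight a b x) =ᵐ[volume.restrict (Set.Icc 0 1)] weight (a + n) b := by
  have h0 : ∀ᵐ x ∂(volume.restrict (Set.Icc (0 : ℝ) 1)), x ≠ 0 := by
    refine ae_restrict_of_ae ?_
    simp [ae_iff]
  filter_upwards [h0, ae_restrict_mem measurableSet_Icc] with x hx hx'
  have hpos : 0 < x := lt_of_le_of_ne hx'.1 (Ne.symm hx)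
  rw [weight, weight, ← mul_assoc, show a + n - 1 = n + (a - 1) by ring, Real.rpow_add hpos,
    Real.rpow_natCast]

theorem integrable_pow_mul_weight {a b : ℝ} (ha : 0 < a) (hb : 0 < b) (n : ℕ) :
    Integrable (fun x => x ^ n * weight a b x) (volume.restrict (Set.Icc 0 1)) :=
  (integrableOn_weight (by positivity) hb).congr (pow_mul_weight a b n).symm

theorem integral_pow_mul_weight {a b : ℝ} (ha : 0 < a) (hb : 0 < b) (n : ℕ) :
    ∫ x in Set.Icc (0 : ℝ) 1, x ^ n * weight a b x =
      Real.Gamma (a + n) * Real.Gamma b / Real.Gamma (a + b + n) := by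
  rw [integral_congr_ae (pow_mul_weight a b n), integral_weight (by positivity) hb]
  congr 2; ring

theorem restrict_Icc_eq_pi (N : ℕ) :
    (volume : Measure (Fin N → ℝ)).restrict (Set.Icc 0 1) =
      Measure.pi fun _ => volume.restrict (Set.Icc (0 : ℝ) 1) := by
  rw [← Measure.restrict_pi_pi, volume_pi, ← Set.pi_univ_Icc]
  rfl

/-! ### Averages as moment determinants -/

/-- The alternant `det (x_i^(l_j))`. -/
noncomputable def alternant {N : ℕ} (l : Fin N → ℕ) (x : Fin N → ℝ) : ℝ :=
  (Matrix.of fun i j => x i ^ l j).det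

/-- The exponents `N - 1, N - 2, …, 0` of the Vandermonde determinant. -/
def staircase (N : ℕ) (j : Fin N) : ℕ := N - 1 - j

/-- The weight is absorbed into the rows of the first matrix, which gives the form required by
Andréief's identity. -/
theorem prod_weight_mul_alternants {N : ℕ} (a b : ℝ) (l : Fin N → ℕ) (x : Fin N → ℝ) :
    alternant l x * alternant (staircase N) x * ∏ i, weight a b (x i) =
      (Matrix.of fun i j => (fun t : ℝ => t ^ l j * weight a b t) (x i)).det *
        (Matrix.of fun i j => (fun t : ℝ => t ^ staircase N j) (x i)).det := by
  have h := Matrix.det_mul_column (fun i => weight a b (x i)) (Matrix.of fun i j => x i ^ l j)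
  simp only [Matrix.of_apply] at h
  simp only [alternant, mul_comm (_ ^ _) (weight _ _ _), h]
  ring

theorem integrand_schur (N : ℕ) (a b : ℝ) (lam : YoungDiagram) (x : Fin N → ℝ) :
    integrand N a b (schur N lam) x =
      alternant (fun j => lam.rowLen j + staircase N j) x * alternant (staircase N) x *
        ∏ i, weight a b (x i) := by
  have hV : alternant (staircase N) x = ∏ i : Fin N, ∏ j ∈ Finset.Ioi i, (x i - x j) :=
    (prod_sub_eq_det x).symm
  simp only [integrand, schur, Finset.prod_pow, ← hV]
  simp only [alternant, staircase, weight]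
  by_cases h : (Matrix.of fun i j : Fin N => x i ^ (N - 1 - (j : ℕ))).det = 0
  · simp [h]
  · field_simp

theorem integrand_one (N : ℕ) (a b : ℝ) (x : Fin N → ℝ) :
    integrand N a b (fun _ => 1) x =
      alternant (staircase N) x * alternant (staircase N) x * ∏ i, weight a b (x i) := by
  have hV : alternant (staircase N) x = ∏ i : Fin N, ∏ j ∈ Finset.Ioi i, (x i - x j) :=
    (prod_sub_eq_det x).symm
  simp only [integrand, Finset.prod_pow, ← hV, weight]
  ring

theorem integrable_pow_mul_weight_mul_pow {a b : ℝ} (ha : 0 < a) (hb : 0 < b) (m n : ℕ) :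
    Integrable (fun t : ℝ => t ^ m * weight a b t * t ^ n)
      (volume.restrict (Set.Icc 0 1)) := by
  refine (integrable_pow_mul_weight ha hb (m + n)).congr (ae_of_all _ fun t => ?_)
  simp only [pow_add]; ring

theorem integrableOn_alternants {N : ℕ} {a b : ℝ} (ha : 0 < a) (hb : 0 < b) (l : Fin N → ℕ) :
    IntegrableOn (fun x => alternant l x * alternant (staircase N) x * ∏ i, weight a b (x i))
      (Set.Icc (0 : Fin N → ℝ) 1) := by
  rw [IntegrableOn, restrict_Icc_eq_pi]
  simp only [prod_weight_mul_alternants]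
  exact integrable_det_mul_det fun j k => integrable_pow_mul_weight_mul_pow ha hb _ _

theorem integral_alternants {N : ℕ} {a b : ℝ} (ha : 0 < a) (hb : 0 < b) (l : Fin N → ℕ) :
    ∫ x in Set.Icc (0 : Fin N → ℝ) 1,
        alternant l x * alternant (staircase N) x * ∏ i, weight a b (x i) =
      N.factorial * (Matrix.of fun j k : Fin N =>
        Real.Gamma (a + (l j + staircase N k : ℕ)) * Real.Gamma b /
          Real.Gamma (a + b + (l j + staircase N k : ℕ))).det := by
  rw [restrict_Icc_eq_pi]
  simp only [prod_weight_mul_alternants]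
  rw [integral_det_mul_det fun j k => integrable_pow_mul_weight_mul_pow ha hb _ _]
  congr 3
  ext j k
  rw [← integral_pow_mul_weight ha hb]
  refine integral_congr_ae (ae_of_all _ fun t => ?_)
  simp only [pow_add]; ring

/-! ### Factorization of the moment determinant -/

theorem Gamma_add_nat {x : ℝ} (hx : 0 < x) (n : ℕ) :
    Real.Gamma (x + n) = (∏ t ∈ range n, (x + t)) * Real.Gamma x := by
  induction n with
  | zero => simp
  | succ n ih =>
    rw [Nat.cast_succ, ← add_assoc, Real.Gamma_add_one (by positivity), ih, prod_range_succ]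
    ring

/-- The factor of a row of the matrix of moments that is not polynomial in the exponent. -/
noncomputable def rowFactor (N : ℕ) (a b : ℝ) (n : ℕ) : ℝ :=
  Real.Gamma b * Real.Gamma (a + n) / Real.Gamma (a + b + (n + (N - 1) : ℕ))

/-- The polynomial giving the remaining factor of the moments in column `k`. -/
noncomputable def columnPoly (N : ℕ) (a b : ℝ) (k : Fin N) : Polynomial ℝ :=
  (∏ t ∈ range (staircase N k), (Polynomial.X + Polynomial.C (a + t))) *
    ∏ t ∈ range (k : ℕ), (Polynomial.X + Polynomial.C (a + b + staircase N k + t))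

theorem natDegree_columnPoly_lt (N : ℕ) (a b : ℝ) (k : Fin N) :
    (columnPoly N a b k).natDegree < N := by
  have h (s : Finset ℕ) (c : ℕ → ℝ) :
      (∏ t ∈ s, (Polynomial.X + Polynomial.C (c t))).natDegree = s.card := by
    rw [Polynomial.natDegree_prod_of_monic _ _ fun t _ => Polynomial.monic_X_add_C _]
    simp
  refine lt_of_le_of_lt Polynomial.natDegree_mul_le ?_
  -- The degrees add up to `(N - 1 - k) + k = N - 1`.
  rw [h, h, card_range, card_range, staircase]
  omega

/-- Since `staircase N k + k = N - 1`, raising the argument of the denominator by `k` makes it the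
same in every column; the shifts of both Gamma functions are paid for by polynomials in `n`. -/
theorem moment_eq {N : ℕ} {a b : ℝ} (ha : 0 < a) (hb : 0 < b) (n : ℕ) (k : Fin N) :
    Real.Gamma (a + (n + staircase N k : ℕ)) * Real.Gamma b /
        Real.Gamma (a + b + (n + staircase N k : ℕ)) =
      rowFactor N a b n * (columnPoly N a b k).eval (n : ℝ) := by
  have h1 := Gamma_add_nat (x := a + n) (by positivity) (staircase N k)
  have h2 := Gamma_add_nat (x := a + b + (n + staircase N k : ℕ)) (by positivity) k
  have hN : n + (N - 1) = n + staircase N k + k := by rw [staircase]; omega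
  have hg : Real.Gamma (a + b + (n + staircase N k : ℕ)) ≠ 0 :=
    (Real.Gamma_pos_of_pos (by positivity)).ne'
  have hp : ∏ t ∈ range (k : ℕ), (a + b + ((n + staircase N k : ℕ) : ℝ) + t) ≠ 0 :=
    (Finset.prod_pos fun t _ => by positivity).ne'
  rw [rowFactor, hN, columnPoly, Polynomial.eval_mul, Polynomial.eval_prod,
    Polynomial.eval_prod, Nat.cast_add (n + staircase N k), ← add_assoc (a + b), h2,
    Nat.cast_add n, ← add_assoc a, h1, ← Nat.cast_add n]
  have e1 : ∏ t ∈ range (staircase N k),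
      Polynomial.eval (n : ℝ) (Polynomial.X + Polynomial.C (a + t)) =
      ∏ t ∈ range (staircase N k), (a + n + (t : ℝ)) :=
    prod_congr rfl fun t _ => by simp; ring
  have e2 : ∏ t ∈ range (k : ℕ),
      Polynomial.eval (n : ℝ) (Polynomial.X + Polynomial.C (a + b + staircase N k + t)) =
      ∏ t ∈ range (k : ℕ), (a + b + ((n + staircase N k : ℕ) : ℝ) + t) :=
    prod_congr rfl fun t _ => by simp; ring
  rw [e1, e2]
  field_simp

/-- The part of the moment determinant that does not depend on the exponents. -/
noncomputable def momentConst (N : ℕ) (a b : ℝ) : ℝ :=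
  (Matrix.of fun i k : Fin N => (columnPoly N a b k).coeff i).det

theorem det_moment {N : ℕ} {a b : ℝ} (ha : 0 < a) (hb : 0 < b) (l : Fin N → ℕ) :
    (Matrix.of fun j k : Fin N =>
        Real.Gamma (a + (l j + staircase N k : ℕ)) * Real.Gamma b /
          Real.Gamma (a + b + (l j + staircase N k : ℕ))).det =
      (∏ j, rowFactor N a b (l j)) *
        ((∏ i : Fin N, ∏ j ∈ Finset.Ioi i, ((l j : ℝ) - l i)) * momentConst N a b) := by
  simp only [moment_eq ha hb]
  rw [momentConst, ← Matrix.det_vandermonde (fun j => (l j : ℝ)),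
    ← det_eval_eq_det_vandermonde_mul _ _ (natDegree_columnPoly_lt N a b),
    ← Matrix.det_mul_column]
  rfl

/-! ### Convergence, positivity and the ratio over all rows -/

theorem integrableOn_integrand_one {N : ℕ} {a b : ℝ} (ha : 0 < a) (hb : 0 < b) :
    IntegrableOn (integrand N a b fun _ => 1) (Set.Icc (0 : Fin N → ℝ) 1) :=
  (integrableOn_alternants ha hb (staircase N)).congr
    (ae_of_all _ fun x => (integrand_one N a b x).symm)

theorem average_one_pos {N : ℕ} {a b : ℝ} (ha : 0 < a) (hb : 0 < b) :
    0 < average N a b fun _ => 1 := by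
  refine mul_pos (by positivity) ?_
  have hint := integrableOn_integrand_one (N := N) ha hb
  have hnn : 0 ≤ᵐ[volume.restrict (Set.Icc 0 1)] integrand N a b fun _ => 1 := by
    refine ae_restrict_of_forall_mem measurableSet_Icc fun x hx => ?_
    have h1 := hx.1
    have h2 := hx.2
    refine mul_nonneg (mul_nonneg zero_le_one (prod_nonneg fun i _ =>
      prod_nonneg fun j _ => sq_nonneg _)) (prod_nonneg fun i _ => mul_nonneg
        (Real.rpow_nonneg (h1 i) _) (Real.rpow_nonneg (sub_nonneg.2 (h2 i)) _))
  rw [setIntegral_pos_iff_support_of_nonneg_ae hnn hint]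
  -- On the open set `0 < x_1 < ⋯ < x_N < 1` every factor is positive.
  let U : Set (Fin N → ℝ) :=
    (⋂ i, {x | 0 < x i}) ∩ (⋂ i, {x | x i < 1}) ∩ ⋂ i, ⋂ j ∈ Finset.Ioi i, {x | x i < x j}
  have hU : IsOpen U := by
    refine ((isOpen_iInter_of_finite fun i => isOpen_lt continuous_const (continuous_apply i)).inter
      (isOpen_iInter_of_finite fun i => isOpen_lt (continuous_apply i) continuous_const)).inter
      (isOpen_iInter_of_finite fun i => isOpen_biInter_finset fun j _ =>
        isOpen_lt (continuous_apply i) (continuous_apply j))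
  have hne : U.Nonempty := by
    refine ⟨fun i => ((i : ℕ) + 1 : ℝ) / (N + 1), ⟨?_, ?_⟩, ?_⟩
    · simp only [Set.mem_iInter, Set.mem_ofPred_eq]
      intro i; positivity
    · simp only [Set.mem_iInter, Set.mem_ofPred_eq]
      intro i
      rw [div_lt_one (by positivity)]
      have : ((i : ℕ) : ℝ) < N := by exact_mod_cast i.2
      linarith
    · simp only [Set.mem_iInter, Set.mem_ofPred_eq, Finset.mem_Ioi]
      intro i j hij
      have : ((i : ℕ) : ℝ) < (j : ℕ) := by exact_mod_cast hij
      gcongr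
  refine lt_of_lt_of_le (hU.measure_pos volume hne) (measure_mono fun x hx => ?_)
  simp only [U, Set.mem_inter_iff, Set.mem_iInter, Set.mem_ofPred_eq, Finset.mem_Ioi] at hx
  obtain ⟨⟨h0, h1⟩, h2⟩ := hx
  refine ⟨ne_of_gt ?_, fun i => (h0 i).le, fun i => (h1 i).le⟩
  refine mul_pos (mul_pos one_pos (prod_pos fun i _ => prod_pos fun j hj => ?_))
    (prod_pos fun i _ => mul_pos (Real.rpow_pos_of_pos (h0 i) _)
      (Real.rpow_pos_of_pos (sub_pos.2 (h1 i)) _))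
  exact even_two.pow_pos (sub_neg.2 (h2 i j (Finset.mem_Ioi.1 hj))).ne

theorem integrableOn_integrand_schur {N : ℕ} {a b : ℝ} (ha : 0 < a) (hb : 0 < b)
    (lam : YoungDiagram) :
    IntegrableOn (integrand N a b (schur N lam)) (Set.Icc (0 : Fin N → ℝ) 1) :=
  (integrableOn_alternants ha hb _).congr
    (ae_of_all _ fun x => (integrand_schur N a b lam x).symm)

theorem average_schur {N : ℕ} {a b : ℝ} (ha : 0 < a) (hb : 0 < b) (lam : YoungDiagram) :
    average N a b (schur N lam) =
      (∏ j : Fin N, rowFactor N a b (lam.rowLen j + staircase N j)) *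
        ((∏ i : Fin N, ∏ j ∈ Finset.Ioi i, (((lam.rowLen j + staircase N j : ℕ) : ℝ) -
          (lam.rowLen i + staircase N i : ℕ))) * momentConst N a b) := by
  have h : (N.factorial : ℝ) ≠ 0 := by positivity
  rw [average, integral_congr_ae (ae_of_all _ (integrand_schur N a b lam)),
    integral_alternants ha hb, det_moment ha hb, ← mul_assoc, one_div_mul_cancel h, one_mul]

theorem average_one {N : ℕ} {a b : ℝ} (ha : 0 < a) (hb : 0 < b) :
    average N a b (fun _ => 1) =
      (∏ j : Fin N, rowFactor N a b (staircase N j)) *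
        ((∏ i : Fin N, ∏ j ∈ Finset.Ioi i, ((staircase N j : ℝ) - staircase N i)) *
          momentConst N a b) := by
  have h : (N.factorial : ℝ) ≠ 0 := by positivity
  rw [average, integral_congr_ae (ae_of_all _ (integrand_one N a b)),
    integral_alternants ha hb, det_moment ha hb, ← mul_assoc, one_div_mul_cancel h, one_mul]

theorem rowFactor_add_div {N : ℕ} {a b : ℝ} (ha : 0 < a) (hb : 0 < b) (m n : ℕ) :
    rowFactor N a b (m + n) / rowFactor N a b n =
      ∏ t ∈ range m, (a + n + t) / (a + b + (n + (N - 1) : ℕ) + t) := by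
  have h1 := Gamma_add_nat (x := a + n) (by positivity) m
  have h2 := Gamma_add_nat (x := a + b + (n + (N - 1) : ℕ)) (by positivity) m
  have g1 : Real.Gamma b ≠ 0 := (Real.Gamma_pos_of_pos hb).ne'
  have g2 : Real.Gamma (a + n) ≠ 0 := (Real.Gamma_pos_of_pos (by positivity)).ne'
  have g3 : Real.Gamma (a + b + (n + (N - 1) : ℕ)) ≠ 0 :=
    (Real.Gamma_pos_of_pos (by positivity)).ne'
  have g4 : ∏ t ∈ range m, (a + b + ((n + (N - 1) : ℕ) : ℝ) + t) ≠ 0 :=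
    (Finset.prod_pos fun t _ => by positivity).ne'
  rw [prod_div_distrib, rowFactor, rowFactor, add_comm m n, add_right_comm n m,
    Nat.cast_add n m, Nat.cast_add _ m, ← add_assoc a, ← add_assoc (a + b), h1, h2]
  field_simp

theorem staircase_cast {N : ℕ} (j : Fin N) : (staircase N j : ℝ) = N - 1 - (j : ℕ) := by
  have h : staircase N j + 1 + j = N := by rw [staircase]; omega
  have h' : (staircase N j : ℝ) + 1 + (j : ℕ) = N := by exact_mod_cast h
  linarith

/-- The ratio of averages as a product over all `N` rows. -/
theorem average_schur_div {N : ℕ} {a b : ℝ} (ha : 0 < a) (hb : 0 < b) (lam : YoungDiagram) :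
    average N a b (schur N lam) / average N a b (fun _ => 1) =
      ∏ i ∈ range N,
        ((∏ j ∈ Ioo i N, ((lam.rowLen i : ℝ) - lam.rowLen j + j - i) / ((j : ℝ) - i)) *
          ∏ t ∈ range (lam.rowLen i),
            (a + N - (i + 1) + t) / (a + b + 2 * N - (i + 1) + t - 1)) := by
  -- The constant is a factor of `⟨1⟩`, which is positive.
  have hC : momentConst N a b ≠ 0 := by
    have h := (average_one_pos (N := N) ha hb).ne'
    rw [average_one ha hb] at h
    exact right_ne_zero_of_mul (right_ne_zero_of_mul h)
  rw [average_schur ha hb, average_one ha hb, mul_div_mul_comm, mul_div_mul_comm, div_self hC,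
    mul_one, ← prod_div_distrib, ← prod_div_distrib, mul_comm, ← prod_mul_distrib,
    ← Fin.prod_univ_eq_prod_range (fun i : ℕ =>
      ((∏ j ∈ Ioo i N, ((lam.rowLen i : ℝ) - lam.rowLen j + j - i) / ((j : ℝ) - i)) *
          ∏ t ∈ range (lam.rowLen i),
            (a + N - (i + 1) + t) / (a + b + 2 * N - (i + 1) + t - 1)))]
  refine prod_congr rfl fun i _ => ?_
  congr 1
  · rw [← prod_div_distrib, ← Fin.map_valEmbedding_Ioi, prod_map]
    refine prod_congr rfl fun j _ => ?_
    push_cast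
    rw [staircase_cast, staircase_cast, Fin.valEmbedding_apply, ← neg_div_neg_eq]
    congr 1 <;> ring
  · rw [rowFactor_add_div ha hb]
    refine prod_congr rfl fun t _ => ?_
    have hN : ((N - 1 : ℕ) : ℝ) = N - 1 := by
      rw [Nat.cast_sub (by have := i.2; omega), Nat.cast_one]
    push_cast
    rw [staircase_cast, hN]
    congr 1 <;> ring

/-! ### Reduction to the nonzero rows -/

theorem prod_range_succ_div (u : ℕ → ℝ) (hu : ∀ t, u t ≠ 0) (m : ℕ) :
    ∏ t ∈ range m, u (t + 1) / u t = u m / u 0 := by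
  induction m with
  | zero => rw [range_zero, prod_empty, div_self (hu 0)]
  | succ m ih => rw [prod_range_succ, ih, mul_comm, div_mul_div_cancel₀ (hu m)]

/-- Two ways of writing a ratio of binomial coefficients. -/
theorem prod_Ico_add_div {i l N : ℕ} (hi : i < l) (hN : l ≤ N) (m : ℕ) :
    ∏ j ∈ Ico l N, ((m : ℝ) + j - i) / ((j : ℝ) - i) =
      ∏ t ∈ range m, ((t : ℝ) + N - i) / ((t : ℝ) + l - i) := by
  induction N, hN using Nat.le_induction with
  | base =>
    rw [Ico_self, prod_empty]
    refine (prod_eq_one fun t _ => div_self ?_).symm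
    have : (i : ℝ) < l := by exact_mod_cast hi
    have := t.cast_nonneg (α := ℝ)
    exact ne_of_gt (by linarith)
  | succ N hN ih =>
    have hiN : (i : ℝ) < N := by exact_mod_cast hi.trans_le hN
    have hpos (t : ℕ) : (t : ℝ) + N - i ≠ 0 := by
      have := t.cast_nonneg (α := ℝ)
      exact ne_of_gt (by linarith)
    -- The new factor `(m + N - i) / (N - i)` is spread over `t < m` as a telescoping product,
    -- raising `N` to `N + 1` in each numerator.
    have htel := prod_range_succ_div (fun t : ℕ => (t : ℝ) + N - i) hpos m
    rw [prod_Ico_succ_top hN, ih]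
    rw [Nat.cast_zero, zero_add] at htel
    rw [← htel, ← prod_mul_distrib]
    refine prod_congr rfl fun t _ => ?_
    rw [mul_comm, div_mul_div_cancel₀ (hpos t)]
    push_cast
    congr 1; ring

theorem rowLen_eq_zero {lam : YoungDiagram} {i : ℕ} (h : length lam ≤ i) : lam.rowLen i = 0 := by
  by_contra hne
  have : (i, 0) ∈ lam := YoungDiagram.mem_iff_lt_rowLen.2 (Nat.pos_of_ne_zero hne)
  exact absurd (YoungDiagram.mem_iff_lt_colLen.1 this) (not_lt.2 h)

theorem average_schur_div_eq {N : ℕ} {a b : ℝ} (lam : YoungDiagram) (hN : length lam ≤ N)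
    (ha : 0 < a) (hb : 0 < b) :
    average N a b (schur N lam) / average N a b (fun _ => 1) =
      ∏ i ∈ range (length lam),
        ((∏ j ∈ Ioo i (length lam),
            ((lam.rowLen i : ℝ) - lam.rowLen j + j - i) / ((j : ℝ) - i)) *
          ∏ j ∈ range (lam.rowLen i),
            (((j : ℝ) + N - (i + 1) + 1) * (a + N - (i + 1) + j)) /
              (((length lam : ℝ) + j - (i + 1) + 1) *
                (a + b + 2 * N - (i + 1) + j - 1))) := by
  rw [average_schur_div ha hb, ← prod_range_mul_prod_Ico _ hN]
  have htail : ∏ i ∈ Ico (length lam) N,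
      ((∏ j ∈ Ioo i N, ((lam.rowLen i : ℝ) - lam.rowLen j + j - i) / ((j : ℝ) - i)) *
          ∏ t ∈ range (lam.rowLen i),
            (a + N - (i + 1) + t) / (a + b + 2 * N - (i + 1) + t - 1)) = 1 := by
    refine prod_eq_one fun i hi => ?_
    have hli := (mem_Ico.1 hi).1
    rw [rowLen_eq_zero hli, range_zero, prod_empty, mul_one]
    refine prod_eq_one fun j hj => ?_
    have hij := (mem_Ioo.1 hj).1
    have hij' : (i : ℝ) < j := by exact_mod_cast hij
    rw [rowLen_eq_zero (hli.trans hij.le), sub_self, zero_add, div_self (by linarith)]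
  rw [htail, mul_one]
  refine prod_congr rfl fun i hi => ?_
  have hil := mem_range.1 hi
  have hsplit : Ioo i N = Ioo i (length lam) ∪ Ico (length lam) N := by
    ext j; simp only [mem_Ioo, mem_union, mem_Ico]; omega
  have hdisj : Disjoint (Ioo i (length lam)) (Ico (length lam) N) := by
    rw [disjoint_left]; intro j; simp only [mem_Ioo, mem_Ico]; omega
  have hrest : ∏ j ∈ Ico (length lam) N,
      ((lam.rowLen i : ℝ) - lam.rowLen j + j - i) / ((j : ℝ) - i) =
      ∏ t ∈ range (lam.rowLen i), ((t : ℝ) + N - i) / ((t : ℝ) + length lam - i) := by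
    rw [← prod_Ico_add_div hil hN]
    refine prod_congr rfl fun j hj => ?_
    rw [rowLen_eq_zero (mem_Ico.1 hj).1, Nat.cast_zero, sub_zero]
  rw [hsplit, prod_union hdisj, hrest, mul_assoc, ← prod_mul_distrib]
  congr 1
  refine prod_congr rfl fun t _ => ?_
  rw [div_mul_div_comm]
  congr 2 <;> ring

/-! ### Asymptotics -/

theorem tendsto_add_const_div (c d : ℝ) :
    Filter.Tendsto (fun N : ℕ => (c * N + d) / N) Filter.atTop (nhds c) := by
  have hlim : Filter.Tendsto (fun N : ℕ => c + d / N) Filter.atTop (nhds c) := by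
    simpa using tendsto_const_nhds.add (tendsto_const_div_atTop_nhds_zero_nat d)
  refine hlim.congr' ?_
  filter_upwards [Filter.eventually_gt_atTop 0] with N hpos
  have hpos' : (0 : ℝ) < N := by exact_mod_cast hpos
  field_simp

theorem nonneg_of_eventually_pos {c d : ℝ}
    (h : ∀ᶠ N : ℕ in Filter.atTop, 0 < c * N + d) : 0 ≤ c := by
  refine ge_of_tendsto (tendsto_add_const_div c d) ?_
  filter_upwards [h] with N hN
  positivity

theorem tendsto_factor (a₀ a₁ b₀ b₁ l : ℝ) (i j : ℕ) (h : 2 + a₁ + b₁ ≠ 0) :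
    Filter.Tendsto (fun N : ℕ =>
      (((j : ℝ) + N - (i + 1) + 1) * (a₁ * N + a₀ + N - (i + 1) + j)) /
        ((l + j - (i + 1) + 1) *
          (a₁ * N + a₀ + (b₁ * N + b₀) + 2 * N - (i + 1) + j - 1)) / N)
      Filter.atTop
      (nhds ((1 + a₁) / (2 + a₁ + b₁) * (1 / (l + j - (i + 1) + 1)))) := by
  have h1 := tendsto_add_const_div 1 ((j : ℝ) - i)
  have h2 := tendsto_add_const_div (1 + a₁) (a₀ - (i + 1) + j)
  have h3 := tendsto_add_const_div (2 + a₁ + b₁) (a₀ + b₀ - (i + 1) + j - 1)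
  have h4 := ((h1.mul h2).div h3 h).mul_const (1 / (l + j - (i + 1) + 1))
  rw [one_mul] at h4
  refine h4.congr' ?_
  filter_upwards [Filter.eventually_gt_atTop 0] with N hpos
  have hpos' : (N : ℝ) ≠ 0 := by exact_mod_cast hpos.ne'
  have e1 : (j : ℝ) + N - (i + 1) + 1 = 1 * N + (j - i) := by ring
  have e2 : a₁ * N + a₀ + N - (i + 1) + j = (1 + a₁) * N + (a₀ - (i + 1) + j) := by ring
  have e3 : a₁ * N + a₀ + (b₁ * N + b₀) + 2 * N - (i + 1) + j - 1 =
      (2 + a₁ + b₁) * N + (a₀ + b₀ - (i + 1) + j - 1) := by ring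
  simp only [Pi.div_apply, e1, e2, e3]
  generalize (1 * N + (j - i) : ℝ) = A
  generalize (1 + a₁) * N + (a₀ - (i + 1) + j) = B
  generalize (2 + a₁ + b₁) * N + (a₀ + b₀ - (i + 1) + j - 1) = D
  generalize l + j - (i + 1) + 1 = E
  -- If `D` or `E` is zero, both sides are `0` by the convention for division.
  rcases eq_or_ne D 0 with rfl | hD
  · simp
  rcases eq_or_ne E 0 with rfl | hE
  · simp
  field_simp

/-- One factor per box lets the powers of `N` and of the limit constant be distributed over the
product formula. -/
theorem pow_size (lam : YoungDiagram) (c : ℝ) :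
    c ^ size lam = ∏ i ∈ range (length lam), ∏ _j ∈ range (lam.rowLen i), c := by
  simp only [size, prod_const, card_range, prod_pow_eq_pow_sum]

end Selberg

/-- The indices `i`, `j` of rows start at `0`, so that `i + 1`, `j + 1` are the usual indices of
parts; the index of the inner products over `Finset.range (lam.rowLen i)` is unshifted. -/
theorem mainTheorem3 (lam : YoungDiagram) :
    (∀ (N : ℕ) (a b : ℝ), Selberg.length lam ≤ N → 0 < a → 0 < b →
      MeasureTheory.IntegrableOn (Selberg.integrand N a b (Selberg.schur N lam))
        (Set.Icc (0 : Fin N → ℝ) 1) ∧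
      MeasureTheory.IntegrableOn (Selberg.integrand N a b (fun _ => 1))
        (Set.Icc (0 : Fin N → ℝ) 1) ∧
      0 < Selberg.average N a b (fun _ => 1) ∧
      Selberg.average N a b (Selberg.schur N lam) / Selberg.average N a b (fun _ => 1) =
        ∏ i ∈ Finset.range (Selberg.length lam),
          ((∏ j ∈ Finset.Ioo i (Selberg.length lam),
              ((lam.rowLen i : ℝ) - lam.rowLen j + j - i) / ((j : ℝ) - i)) *
            ∏ j ∈ Finset.range (lam.rowLen i),
              (((j : ℝ) + N - (i + 1) + 1) * (a + N - (i + 1) + j)) /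
                (((Selberg.length lam : ℝ) + j - (i + 1) + 1) *
                  (a + b + 2 * N - (i + 1) + j - 1)))) ∧
    (∀ a₀ a₁ b₀ b₁ : ℝ,
      (∀ᶠ N : ℕ in Filter.atTop, 0 < a₁ * N + a₀ ∧ 0 < b₁ * N + b₀) →
      Filter.Tendsto
        (fun N : ℕ =>
          Selberg.average N (a₁ * N + a₀) (b₁ * N + b₀) (Selberg.schur N lam) /
            ((N : ℝ) ^ Selberg.size lam *
              Selberg.average N (a₁ * N + a₀) (b₁ * N + b₀) (fun _ => 1)))
        Filter.atTop
        (nhds (((1 + a₁) / (2 + a₁ + b₁)) ^ Selberg.size lam *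
          ∏ i ∈ Finset.range (Selberg.length lam),
            ((∏ j ∈ Finset.Ioo i (Selberg.length lam),
                ((lam.rowLen i : ℝ) - lam.rowLen j + j - i) / ((j : ℝ) - i)) *
              ∏ j ∈ Finset.range (lam.rowLen i),
                1 / ((Selberg.length lam : ℝ) + j - (i + 1) + 1))))) := by
  refine ⟨fun N a b hN ha hb => ⟨Selberg.integrableOn_integrand_schur ha hb lam,
    Selberg.integrableOn_integrand_one ha hb, Selberg.average_one_pos ha hb,
    Selberg.average_schur_div_eq lam hN ha hb⟩, fun a₀ a₁ b₀ b₁ hpos => ?_⟩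
  -- Eventual positivity of `a` and `b` forces nonnegative slopes, so the limiting denominator is at
  -- least 2.
  have ha₁ : 0 ≤ a₁ := Selberg.nonneg_of_eventually_pos (hpos.mono fun _ h => h.1)
  have hb₁ : 0 ≤ b₁ := Selberg.nonneg_of_eventually_pos (hpos.mono fun _ h => h.2)
  have hne : 2 + a₁ + b₁ ≠ 0 := by positivity
  rw [Selberg.pow_size, ← Finset.prod_mul_distrib]
  simp_rw [mul_left_comm (∏ _ ∈ Finset.range _, _ : ℝ), ← Finset.prod_mul_distrib]
  have hlim := tendsto_finsetProd (Finset.range (Selberg.length lam)) fun i _ =>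
    (tendsto_finsetProd (Finset.range (lam.rowLen i)) fun j _ =>
      Selberg.tendsto_factor a₀ a₁ b₀ b₁ (Selberg.length lam) i j hne).const_mul
        (∏ j ∈ Finset.Ioo i (Selberg.length lam),
          ((lam.rowLen i : ℝ) - lam.rowLen j + j - i) / ((j : ℝ) - i))
  refine hlim.congr' ?_
  filter_upwards [hpos, Filter.eventually_ge_atTop (Selberg.length lam)] with N hN hl
  rw [mul_comm ((N : ℝ) ^ _), ← div_div, Selberg.average_schur_div_eq lam hl hN.1 hN.2,
    Selberg.pow_size, ← Finset.prod_div_distrib]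
  refine Finset.prod_congr rfl fun i _ => ?_
  rw [mul_div_assoc, ← Finset.prod_div_distrib]
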